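/- Lemma. Let $U$ be a finite set and let $\mathcal M=(U,\mathcal L)$, $\mathcal L\subseteq\{-1,0,+1\}^U$, be a simple oriented matroid with set of covectors $\mathcal L$. That is, $\mathbf 0\in\mathcal L$; $\mathcal L=-\mathcal L$; $X\circ Y\in\mathcal L$ for all $X,Y\in\mathcal L$, where $(X\circ Y)_e=X_e$ if $X_e\ne0$ and $(X\circ Y)_e=Y_e$ otherwise; and for all $X,Y\in\mathcal L$ and every $e\in \mathrm{Sep}(X,Y)=\{f\in U: X_fY_f=-1\}$ there is $Z\in\mathcal L$ with $Z_e=0$ and $Z_f=(X\circ Y)_f$ for all $f\in U\setminus \mathrm{Sep}(X,Y)$. Simple means that $\{X_e:X\in\mathcal L\}=\{-1,0,+1\}$ for every $e\in U$, and that for all $e\neq f$ in $U$ there are $X,Y\in\mathcal L$ with $\{X_eX_f,Y_eY_f\}=\{+1,-1\}$. Order $\mathcal L$ by the product order of $0\le -1,+1$ and add a global maximum $\hat 1$; let the rank $d$ of $\mathcal M$ be the length of a longest chain of this poset minus $1$, and let the topes be its co-atoms. Identify a tope $T$ with the set $\{e\in U: T_e=+1\}$, and let the tope graph $G(\mathcal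 M)$ be the subgraph of the hypercube on $2^U$ induced by the topes. Two edges $uv$, $u'v'$ of $G(\mathcal M)$ are in relation $\Theta$ if, for a suitable naming of the ends of $u'v'$, $u'$ is closer to $u$ than to $v$ and $v'$ is closer to $v$ than to $u$. For $e\in U$, let $E_e$ be the $\Theta$-class of the edges whose ends differ exactly in $e$. For a tope $T$, let $\mathrm{osc}(T)$ be the set of all $e\in U$ such that $E_e$ osculates with $\{T\}$, i.e. $E_e$ has no edge inside $\{T\}$ but has an edge with exactly one end in $\{T\}$. Then for every tope $T$ of $\mathcal M$ there is a set $D\subseteq\mathrm{osc}(T)$ with $|D|=d$ that is shattered by $\mathcal M$, i.e. for every $Y\subseteq D$ there is a tope $S$ (seen as a subset of $U$) with $S\cap D=Y$. -/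

import Mathlib

/-! ### Sign vectors -/

namespace SignVec

variable {U : Type*}

/-- The separator of `X` and `Y`. -/
def sep (X Y : U → SignType) : Set U := {e | X e * Y e = -1}

/-- The composition `X ∘ Y`. -/
def comp (X Y : U → SignType) : U → SignType := fun e => if X e = 0 then Y e else X e

/-- The product ordering relative to `0 ≤ -1, +1` (not the linear order of `SignType`). -/
def le (X Y : U → SignType) : Prop := ∀ e, X e = 0 ∨ X e = Y e

end SignVec

/-! ### Oriented matroids -/

/-- An oriented matroid on the ground set `U`, given by its covectors. -/
structure OrientedMatroid (U : Type*) where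
  /-- The set of covectors. -/
  covectors : Set (U → SignType)
  /-- (Z) -/
  zero_mem : (0 : U → SignType) ∈ covectors
  /-- (C), composition -/
  comp_mem : ∀ X ∈ covectors, ∀ Y ∈ covectors, SignVec.comp X Y ∈ covectors
  /-- (SE), strong elimination -/
  strong_elim : ∀ X ∈ covectors, ∀ Y ∈ covectors, ∀ e ∈ SignVec.sep X Y,
    ∃ Z ∈ covectors, Z e = 0 ∧ ∀ f, f ∉ SignVec.sep X Y → Z f = SignVec.comp X Y f
  /-- (Sym), symmetry -/
  neg_mem : ∀ X ∈ covectors, -X ∈ covectors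

namespace OrientedMatroid

variable {U : Type*}

/-- Simple systems of sign vectors: no element is constant, no two elements are parallel. -/
def IsSimple (M : OrientedMatroid U) : Prop :=
  (∀ e, {s : SignType | ∃ X ∈ M.covectors, X e = s} = {-1, 0, 1}) ∧
  ∀ e f, e ≠ f → ∃ X ∈ M.covectors, ∃ Y ∈ M.covectors,
    ({X e * X f, Y e * Y f} : Set SignType) = {1, -1}

/-- The type of covectors, ordered by the sign order. -/
@[ext]
structure Covector (M : OrientedMatroid U) where
  /-- The underlying sign vector. -/
  vec : U → SignType
  mem : vec ∈ M.covectors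

instance (M : OrientedMatroid U) : PartialOrder M.Covector where
  le X Y := SignVec.le X.vec Y.vec
  le_refl _ _ := Or.inr rfl
  le_trans X Y Z hXY hYZ e := by
    rcases hXY e with h | h
    · exact Or.inl h
    · rcases hYZ e with h' | h'
      · exact Or.inl (h.trans h')
      · exact Or.inr (h.trans h')
  le_antisymm X Y hXY hYX := by
    ext e
    rcases hXY e with h | h
    · rcases hYX e with h' | h'
      · rw [h, h']
      · exact h'.symm
    · exact h

/-- The big face lattice: the covectors with an artificial global maximum. -/
abbrev BigFaceLattice (M : OrientedMatroid U) : Type _ := WithTop M.Covector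

/-- The rank: the length (number of strict steps) of a longest chain of the big face lattice,
minus one. The truncations are harmless for finite `U`, see `krullDim_bigFaceLattice`. -/
noncomputable def rank (M : OrientedMatroid U) : ℕ :=
  ((Order.krullDim M.BigFaceLattice).unbotD 0).toNat - 1

instance (M : OrientedMatroid U) : Nonempty M.Covector := ⟨⟨0, M.zero_mem⟩⟩

instance [Finite U] (M : OrientedMatroid U) : Finite M.Covector :=
  Finite.of_injective Covector.vec fun _ _ h => Covector.ext h

theorem krullDim_bigFaceLattice [Finite U] (M : OrientedMatroid U) :
    Order.krullDim M.BigFaceLattice = ((M.rank + 1 : ℕ) : WithBot ℕ∞) := by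
  have : FiniteDimensionalOrder M.Covector := by
    have := Fintype.ofFinite M.Covector
    rcases finiteDimensionalOrder_or_infiniteDimensionalOrder M.Covector with h | h
    · exact h
    · have hc := Fintype.card_le_of_injective _
        (LTSeries.withLength M.Covector (Fintype.card M.Covector)).strictMono.injective
      rw [LTSeries.length_withLength, Fintype.card_fin] at hc
      omega
  have h : Order.krullDim M.Covector = ((LTSeries.longestOf M.Covector).length : WithBot ℕ∞) :=
    Order.krullDim_eq_length_of_finiteDimensionalOrder
  have h2 : Order.krullDim M.BigFaceLattice
      = (((LTSeries.longestOf M.Covector).length + 1 : ℕ) : WithBot ℕ∞) := by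
    rw [Order.krullDim_WithTop, h]
    rfl
  have h3 : M.rank = (LTSeries.longestOf M.Covector).length := by
    unfold rank
    rw [h2]
    rfl
  rw [h2, h3]

/-- The topes: the covectors that are co-atoms of the big face lattice. -/
def topes (M : OrientedMatroid U) : Set (U → SignType) :=
  {T | ∃ h : T ∈ M.covectors, IsCoatom ((⟨T, h⟩ : M.Covector) : M.BigFaceLattice)}

/-- The subset of `U` corresponding to a tope: the elements with sign `+1`. -/
def positivePart [Fintype U] (T : U → SignType) : Finset U := {e | T e = 1}

open Classical in
/-- The topes, seen as a family of subsets of `U`. -/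
noncomputable def topeFamily [Fintype U] (M : OrientedMatroid U) : Finset (Finset U) :=
  {S | ∃ T ∈ M.topes, positivePart T = S}

end OrientedMatroid

/-! ### The hypercube, `Θ`-classes and osculation -/

section Graph

variable {U : Type*} [DecidableEq U]

/-- The hypercube `Q(U)`. -/
def hypercube (U : Type*) [DecidableEq U] : SimpleGraph (Finset U) where
  Adj A B := (symmDiff A B).card = 1
  symm := ⟨fun A B h => by rwa [symmDiff_comm]⟩
  loopless := ⟨fun A h => by simp at h⟩

/-- The 1-inclusion graph of a family of subsets of `U`. -/
def oneInclusionGraph (F : Finset (Finset U)) : SimpleGraph F :=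
  (hypercube U).comap Subtype.val

/-- The halfspace `W(u, v)`. -/
def halfspace {V : Type*} (G : SimpleGraph V) (u v : V) : Set V := {x | G.dist x u < G.dist x v}

/-- The relation `Θ` between the edges `uv` and `u'v'`. -/
def Theta {V : Type*} (G : SimpleGraph V) (u v u' v' : V) : Prop :=
  u' ∈ halfspace G u v ∧ v' ∈ halfspace G v u

/-- The `Θ`-class `E_e` of the 1-inclusion graph of `F` that corresponds to the coordinate `e`:
all edges in relation `Θ` to an edge whose two ends differ exactly in `e`. -/
def thetaClass (F : Finset (Finset U)) (e : U) : Set (Sym2 F) :=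
  {p | ∃ u v u' v' : F, (oneInclusionGraph F).Adj u v ∧ symmDiff u.1 v.1 = {e} ∧
    (oneInclusionGraph F).Adj u' v' ∧ Theta (oneInclusionGraph F) u v u' v' ∧ p = s(u', v')}

/-- `E_e` crosses the (convex) subgraph induced by `H`. -/
def Crosses (F : Finset (Finset U)) (e : U) (H : Set F) : Prop :=
  ∃ u v : F, s(u, v) ∈ thetaClass F e ∧ u ∈ H ∧ v ∈ H

/-- `E_e` and the (convex) subgraph induced by `H` osculate. -/
def Osculates (F : Finset (Finset U)) (e : U) (H : Set F) : Prop :=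
  ¬ Crosses F e H ∧ ∃ u v : F, s(u, v) ∈ thetaClass F e ∧ u ∈ H ∧ v ∉ H

/-- `osc(H)` -/
def osc (F : Finset (Finset U)) (H : Set F) : Set U := {e | Osculates F e H}

end Graph

namespace OrientedMatroid

variable {U : Type*} [Fintype U]

/-- The vertex of the tope graph that corresponds to a tope. -/
noncomputable def topeVertex (M : OrientedMatroid U) (T : U → SignType) (hT : T ∈ M.topes) :
    M.topeFamily :=
  ⟨positivePart T, by
    simp only [topeFamily, Finset.mem_filter, Finset.mem_univ, true_and]
    exact ⟨T, hT, rfl⟩⟩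

/-- `D` is shattered by `M`, i.e. by the family of its topes. -/
def Shatters [DecidableEq U] (M : OrientedMatroid U) (D : Finset U) : Prop :=
  M.topeFamily.Shatters D

end OrientedMatroid

namespace OrientedMatroid

variable {U : Type*}

/-! Call `e` a wall of `T` if reversing `T` at `e` gives a tope; every wall osculates with `T`. A
tope other than `T` is separated from it by a wall (`exists_wall`). So a covector `X` vanishing on
all walls satisfies `X ∘ T = T = (-X) ∘ T`, forcing `X = 0`. Thus the walls meet every nonzero
support, a property inherited by contractions. Repeatedly contracting a wall on which some covector
is nonzero costs at most one chain step each time, so it yields `d` independent walls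
(`exists_independent`). Every sign pattern on them extends to a covector, and composing with `T`
makes it a tope. -/

/-- The covectors that vanish at `w`, i.e. the contraction of `w` (kept as a loop). -/
def contract (M : OrientedMatroid U) (w : U) : OrientedMatroid U where
  covectors := {X | X ∈ M.covectors ∧ X w = 0}
  zero_mem := ⟨M.zero_mem, rfl⟩
  comp_mem X hX Y hY := ⟨M.comp_mem X hX.1 Y hY.1, by simp [SignVec.comp, hX.2, hY.2]⟩
  strong_elim X hX Y hY e he := by
    obtain ⟨Z, hZ, hZe, hZf⟩ := M.strong_elim X hX.1 Y hY.1 e he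
    refine ⟨Z, ⟨hZ, ?_⟩, hZe, hZf⟩
    rw [hZf w (by simp [SignVec.sep, hX.2])]
    simp [SignVec.comp, hX.2, hY.2]
  neg_mem X hX := ⟨M.neg_mem X hX.1, by simp [hX.2]⟩

/-! ### Chains of covectors under contraction -/

/-- There is a chain of `n` strict steps of covectors starting at `X`. -/
def HasChainAbove (M : OrientedMatroid U) : ℕ → (U → SignType) → Prop
  | 0, _ => True
  | n + 1, X => ∃ Y ∈ M.covectors, SignVec.le X Y ∧ X ≠ Y ∧ M.HasChainAbove n Y

theorem _root_.SignVec.le_trans {X Y Z : U → SignType} (h : SignVec.le X Y)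
    (h' : SignVec.le Y Z) : SignVec.le X Z := by
  intro e
  have := h e
  have := h' e
  grind

theorem _root_.SignVec.le_comp (X Y : U → SignType) : SignVec.le X (SignVec.comp X Y) := by
  intro e
  unfold SignVec.comp
  grind

/-- The first step above `Y` also serves `X`: if `X` were its end `Z`, then `X ≤ Y ≤ Z` would give
`Y = Z`. -/
theorem HasChainAbove.anti {M : OrientedMatroid U} {n : ℕ} {X Y : U → SignType}
    (hXY : SignVec.le X Y) (h : M.HasChainAbove n Y) : M.HasChainAbove n X := by
  cases n with
  | zero => trivial
  | succ n =>
    obtain ⟨Z, hZ, hYZ, hne, hc⟩ := h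
    refine ⟨Z, hZ, SignVec.le_trans hXY hYZ, ?_, hc⟩
    rintro rfl
    apply hne
    ext1 e
    have := hXY e
    have := hYZ e
    grind

theorem hasChainAbove_of_ltSeries (M : OrientedMatroid U) (n : ℕ) :
    ∀ p : LTSeries M.Covector, p.length = n → M.HasChainAbove n p.head.vec := by
  induction n with
  | zero => intros; trivial
  | succ n ih =>
    intro p hp
    have hne : p.length ≠ 0 := by omega
    have hlt : p.head < (p.tail hne).head := by
      rw [RelSeries.head_tail]
      apply p.strictMono
      rw [Fin.lt_def]
      simp [hp]
    refine ⟨(p.tail hne).head.vec, (p.tail hne).head.mem, hlt.le, ?_, ih _ ?_⟩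
    · intro h
      exact hlt.ne (Covector.ext h)
    · simp [hp]

/-- The 1 subtracted in the rank accounts for the added top, so some chain of covectors has length
`M.rank`; its start may be lowered to `0`. -/
theorem hasChainAbove_rank [Finite U] (M : OrientedMatroid U) : M.HasChainAbove M.rank 0 := by
  have h := M.krullDim_bigFaceLattice
  obtain ⟨p, hp⟩ : ∃ p : LTSeries M.Covector, p.length = M.rank := by
    apply Order.le_krullDim_iff.mp
    rw [Order.krullDim_WithTop] at h
    have h1 : Order.krullDim M.Covector + 1 = (M.rank : WithBot ℕ∞) + 1 := by
      rw [h]; push_cast; rfl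
    have h2 : ((1 : ℕ) : WithBot ℕ∞) = 1 := rfl
    generalize Order.krullDim M.Covector = k at h1
    induction k with
    | bot => simp at h1; exact absurd h1.symm (by exact_mod_cast WithBot.coe_ne_bot)
    | coe k =>
      have h3 : k + 1 = (M.rank : ℕ∞) + 1 := by exact_mod_cast h1
      have h4 : k = (M.rank : ℕ∞) := by
        simpa using h3
      rw [h4]; rfl
  exact (M.hasChainAbove_of_ltSeries _ p hp).anti fun _ => Or.inl rfl

/-- If `V` vanishes at `w` and agrees with `Y` outside the support of `K ≤ Y`, where `K w ≠ 0`,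
then chains above `Y` can be projected to chains above `V` in the contraction. -/
theorem HasChainAbove.contract_of_eqOn {M : OrientedMatroid U} {w : U} {K : U → SignType}
    (hK : K ∈ M.covectors) (hKw : K w ≠ 0) {n : ℕ} :
    ∀ {V Y : U → SignType}, V ∈ (M.contract w).covectors → SignVec.le K Y →
      (∀ f, K f = 0 → V f = Y f) → M.HasChainAbove n Y → (M.contract w).HasChainAbove n V := by
  induction n with
  | zero => intros; trivial
  | succ n ih =>
    rintro V Y hV hKY hVY ⟨Y', hY', hYY', hne, hc⟩
    have hKY' := SignVec.le_trans hKY hYY'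
    -- As `K ≤ Y'`, eliminating between `Y'` and `-K` affects only the support of `K`.
    have hsep (f : U) : f ∈ SignVec.sep Y' (-K) ↔ K f ≠ 0 := by
      simp only [SignVec.sep, Set.mem_ofPred_eq, Pi.neg_apply]
      have := hKY' f
      generalize K f = a at *
      generalize Y' f = b at *
      revert a b
      decide
    obtain ⟨Z, hZ, hZw, hZf⟩ := M.strong_elim Y' hY' (-K) (M.neg_mem K hK) w ((hsep w).2 hKw)
    have hZf' (f : U) (hf : K f = 0) : Z f = Y' f := by
      rw [hZf f (by simp [hsep, hf])]
      simp only [SignVec.comp, Pi.neg_apply, hf]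
      split_ifs with h
      · rw [h]; rfl
      · rfl
    have hag (f : U) (hf : K f = 0) : SignVec.comp V Z f = Y' f := by
      simp only [SignVec.comp, hZf' f hf, hVY f hf]
      have := hYY' f
      grind
    have hZM : Z ∈ (M.contract w).covectors := ⟨hZ, hZw⟩
    refine ⟨SignVec.comp V Z, (M.contract w).comp_mem V hV Z hZM, SignVec.le_comp V Z, ?_,
      ih ((M.contract w).comp_mem V hV Z hZM) hKY' hag hc⟩
    -- `Y` and `Y'` coincide with `K` on its support, so they differ off it, where they are `V` and
    -- `V ∘ Z`.
    intro h
    apply hne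
    ext1 f
    by_cases hf : K f = 0
    · rw [← hag f hf, ← h, hVY f hf]
    · have := hKY f
      have := hKY' f
      grind

/-- Contracting an element shortens chains by at most one. -/
theorem HasChainAbove.contract {M : OrientedMatroid U} {w : U} {n : ℕ} :
    ∀ {V : U → SignType}, V ∈ (M.contract w).covectors → M.HasChainAbove (n + 1) V →
      (M.contract w).HasChainAbove n V := by
  induction n with
  | zero => intros; trivial
  | succ n ih =>
    rintro V hV ⟨Y, hY, hVY, hne, hc⟩
    by_cases hw : Y w = 0
    · exact ⟨Y, ⟨hY, hw⟩, hVY, hne, ih ⟨hY, hw⟩ hc⟩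
    -- The one lost step is the first to leave the contraction; take `K = Y`.
    · refine HasChainAbove.contract_of_eqOn hY hw hV (fun e => Or.inr rfl) ?_ hc
      intro f hf
      have := hVY f
      grind

/-- A set meeting the support of every nonzero covector contains as many independent elements as
a chain of covectors has steps. -/
theorem HasChainAbove.exists_independent [DecidableEq U] {n : ℕ} :
    ∀ {M : OrientedMatroid U} {W : Set U},
      (∀ X ∈ M.covectors, (∀ w ∈ W, X w = 0) → X = 0) → M.HasChainAbove n 0 →
      ∃ D : Finset U, (D : Set U) ⊆ W ∧ D.card = n ∧
        ∀ s : U → SignType, ∃ X ∈ M.covectors, ∀ e ∈ D, s e ≠ 0 → X e = s e := by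
  induction n with
  | zero => exact fun {M W} _ _ => ⟨∅, by simp, rfl, fun s => ⟨0, M.zero_mem, by simp⟩⟩
  | succ n ih =>
    intro M W hW hc
    obtain ⟨Y, hY, -, hne, -⟩ := id hc
    obtain ⟨w, hwW, hYw⟩ : ∃ w ∈ W, Y w ≠ 0 := by
      by_contra! h
      exact hne (hW Y hY h).symm
    obtain ⟨D, hDW, hcard, hD⟩ := ih (M := M.contract w) (fun X hX => hW X hX.1)
      (hc.contract (M.contract w).zero_mem)
    have hwD : w ∉ D := by
      intro hwD
      obtain ⟨X, hX, h⟩ := hD 1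
      have h1 := h w hwD (by simp)
      rw [hX.2] at h1
      simp at h1
    refine ⟨insert w D, ?_, by rw [Finset.card_insert_of_notMem hwD, hcard], fun s => ?_⟩
    · rw [Finset.coe_insert]
      exact Set.insert_subset hwW hDW
    · obtain ⟨X, hX, h⟩ := hD s
      obtain ⟨Y', hY', hs⟩ : ∃ Y' ∈ M.covectors, s w ≠ 0 → Y' w = s w := by
        by_cases hs : Y w = s w
        · exact ⟨Y, hY, fun _ => hs⟩
        · refine ⟨-Y, M.neg_mem Y hY, ?_⟩
          rw [Pi.neg_apply]
          generalize Y w = a at *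
          generalize s w = b at *
          revert a b
          decide
      -- `X` vanishes at `w`, so `Y'` decides the sign there and overrides no prescribed sign on
      -- `D`.
      refine ⟨SignVec.comp X Y', M.comp_mem X hX.1 Y' hY', ?_⟩
      intro e he hse
      rcases Finset.mem_insert.mp he with rfl | he
      · simp [SignVec.comp, hX.2, hs hse]
      · simp [SignVec.comp, h e he hse, hse]

/-! ### Topes and walls -/

theorem mem_topes_iff {M : OrientedMatroid U} (hM : M.IsSimple) {T : U → SignType} :
    T ∈ M.topes ↔ T ∈ M.covectors ∧ ∀ e, T e ≠ 0 := by
  constructor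
  · rintro ⟨h, -, hmax⟩
    refine ⟨h, fun e he => ?_⟩
    obtain ⟨X, hX, hXe⟩ : (1 : SignType) ∈ {s : SignType | ∃ X ∈ M.covectors, X e = s} := by
      rw [hM.1 e]; simp
    have hlt : (⟨T, h⟩ : M.Covector) < ⟨SignVec.comp T X, M.comp_mem T h X hX⟩ := by
      refine lt_of_le_of_ne (SignVec.le_comp T X) fun heq => ?_
      have h1 := congrFun (congrArg Covector.vec heq) e
      simp [SignVec.comp, he, hXe] at h1
    exact WithTop.coe_ne_top (hmax _ (WithTop.coe_lt_coe.mpr hlt))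
  · rintro ⟨h, hT⟩
    refine ⟨h, WithTop.coe_ne_top, fun b hb => ?_⟩
    induction b with
    | top => rfl
    | coe b =>
      have hlt := WithTop.coe_lt_coe.mp hb
      refine absurd ?_ hlt.ne
      ext e
      exact (hlt.le e).resolve_left (hT e)

/-- If two topes differ in at least two elements, one can replace the second by a different tope
lying between them. -/
theorem exists_tope_between {M : OrientedMatroid U} (hM : M.IsSimple) {T T' : U → SignType}
    (hT : T ∈ M.topes) (hT' : T' ∈ M.topes) {e f : U} (hef : e ≠ f) (he : T e ≠ T' e)
    (hf : T f ≠ T' f) :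
    ∃ R ∈ M.topes, R ≠ T ∧ (∀ g, T g = T' g → T g = R g) ∧ ∃ g, T g ≠ T' g ∧ T g = R g := by
  rw [mem_topes_iff hM] at hT hT'
  obtain ⟨hTM, hT0⟩ := hT
  obtain ⟨hTM', hT0'⟩ := hT'
  have hsep (g : U) : g ∈ SignVec.sep T T' ↔ T g ≠ T' g := by
    simp only [SignVec.sep, Set.mem_ofPred_eq]
    have h1 := hT0 g
    have h2 := hT0' g
    generalize T g = a at *
    generalize T' g = b at *
    revert a b
    decide
  have key : ∀ Z ∈ M.covectors, ∀ V ∈ M.covectors, (∀ g, V g ≠ 0) →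
      (∀ g, T g = T' g → Z g = T g) → (∃ g, SignVec.comp Z V g ≠ T g) →
      (∃ g, T g ≠ T' g ∧ SignVec.comp Z V g = T g) →
      ∃ R ∈ M.topes, R ≠ T ∧ (∀ g, T g = T' g → T g = R g) ∧ ∃ g, T g ≠ T' g ∧ T g = R g := by
    intro Z hZ V hV hV0 hag ⟨a, ha⟩ ⟨b, hb, hb'⟩
    refine ⟨SignVec.comp Z V, (mem_topes_iff hM).2 ⟨M.comp_mem Z hZ V hV, fun g => ?_⟩,
      fun h => ha (congrFun h a), fun g hg => ?_, b, hb, hb'.symm⟩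
    · have := hV0 g
      unfold SignVec.comp
      grind
    · have := hag g hg
      have := hT0 g
      unfold SignVec.comp
      grind
  obtain ⟨Z, hZ, hZe, hZg⟩ := M.strong_elim T hTM T' hTM' e ((hsep e).2 he)
  have hag (g : U) (hg : T g = T' g) : Z g = T g := by
    rw [hZg g (by simp [hsep, hg])]
    simp [SignVec.comp, hT0 g]
  -- If neither `Z ∘ T` nor `Z ∘ (-T)` works, `Z` vanishes on the whole separator. Simplicity then
  -- gives `V` agreeing with `T` at `e` and opposite to it at `f`, and `Z ∘ V ∘ T` works.
  by_cases h1 : ∃ g, SignVec.comp Z T g ≠ T g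
  · exact key Z hZ T hTM hT0 hag h1 ⟨e, he, by simp [SignVec.comp, hZe]⟩
  by_cases h2 : ∃ g, T g ≠ T' g ∧ SignVec.comp Z (-T) g = T g
  · refine key Z hZ (-T) (M.neg_mem T hTM) (fun g => ?_) hag ⟨e, ?_⟩ h2
    · have := hT0 g
      rw [Pi.neg_apply]
      generalize T g = a at *
      revert a
      decide
    · have h3 := hT0 e
      simp only [SignVec.comp, hZe, if_true, Pi.neg_apply]
      generalize T e = a at h3 ⊢
      revert a
      decide
  push Not at h1 h2
  have hZf : Z f = 0 := by
    have h3 := h1 f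
    have h4 := h2 f hf
    unfold SignVec.comp at h3 h4
    grind
  obtain ⟨V, hV, hVe, hVf⟩ : ∃ V ∈ M.covectors, V e = T e ∧ V f = -T f := by
    obtain ⟨X, hX, hXef⟩ : ∃ X ∈ M.covectors, X e * X f = -(T e * T f) := by
      obtain ⟨X, hX, Y, hY, hXY⟩ := hM.2 e f hef
      have hm : -(T e * T f) ∈ ({X e * X f, Y e * Y f} : Set SignType) := by
        rw [hXY]
        have h3 := hT0 e
        have h4 := hT0 f
        simp only [Set.mem_insert_iff, Set.mem_singleton_iff]
        generalize T e = a at h3 ⊢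
        generalize T f = b at h4 ⊢
        revert a b
        decide
      rcases hm with h | h
      · exact ⟨X, hX, h.symm⟩
      · exact ⟨Y, hY, (Set.mem_singleton_iff.mp h).symm⟩
    have h3 := hT0 e
    have h4 := hT0 f
    have h5 : (X e = T e ∧ X f = -T f) ∨ (-X e = T e ∧ -X f = -T f) := by
      generalize T e = a at h3 hXef ⊢
      generalize T f = b at h4 hXef ⊢
      generalize X e = c at hXef ⊢
      generalize X f = d at hXef ⊢
      revert a b c d
      decide
    rcases h5 with h | h
    · exact ⟨X, hX, h⟩
    · exact ⟨-X, M.neg_mem X hX, h⟩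
  refine key (SignVec.comp Z V) (M.comp_mem Z hZ V hV) T hTM hT0 (fun g hg => ?_) ⟨f, ?_⟩
    ⟨e, he, ?_⟩
  · have := hag g hg
    have := hT0 g
    unfold SignVec.comp
    grind
  · have h3 := hT0 f
    simp only [SignVec.comp, hZf, hVf, if_true]
    generalize T f = a at h3 ⊢
    revert a
    decide
  · simp [SignVec.comp, hZe, hVe]

/-- A tope distinct from `T` is separated from `T` by a wall of `T`. -/
theorem exists_wall [Fintype U] [DecidableEq U] {M : OrientedMatroid U} (hM : M.IsSimple)
    {T : U → SignType} (hT : T ∈ M.topes) (n : ℕ) :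
    ∀ T' ∈ M.topes, T' ≠ T → ({g | T g ≠ T' g} : Finset U).card ≤ n →
      ∃ e, T e ≠ T' e ∧ Function.update T e (-T e) ∈ M.topes := by
  induction n with
  | zero =>
    intro T' _ hne hcard
    refine absurd ?_ hne
    ext1 g
    by_contra hg
    have : g ∈ ({g | T g ≠ T' g} : Finset U) := by simpa using fun h => hg h.symm
    simp_all
  | succ n ih =>
    intro T' hT' hne hcard
    obtain ⟨e, he⟩ : ∃ e, T e ≠ T' e := by
      by_contra! h
      exact hne (funext fun g => (h g).symm)
    by_cases hf : ∃ f, e ≠ f ∧ T f ≠ T' f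
    · obtain ⟨f, hef, hf⟩ := hf
      -- `R` is separated from `T` by a proper subset of the old separator.
      obtain ⟨R, hR, hRT, hsub, g, hg, hgR⟩ := exists_tope_between hM hT hT' hef he hf
      have hlt : ({g | T g ≠ R g} : Finset U).card < ({g | T g ≠ T' g} : Finset U).card := by
        apply Finset.card_lt_card
        rw [Finset.ssubset_iff_of_subset]
        · exact ⟨g, by simpa using hg, by simpa using hgR⟩
        · intro g hg
          simp only [Finset.mem_filter, Finset.mem_univ, true_and] at hg ⊢
          exact fun h => hg (hsub g h)
      obtain ⟨e, he, h⟩ := ih R hR hRT (by omega)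
      exact ⟨e, fun h => he (hsub e h), h⟩
    · push Not at hf
      refine ⟨e, he, ?_⟩
      convert hT' using 1
      ext1 g
      by_cases hg : g = e
      · subst hg
        have h1 := ((mem_topes_iff hM).1 hT).2 g
        have h2 := ((mem_topes_iff hM).1 hT').2 g
        rw [Function.update_self]
        generalize T g = a at *
        generalize T' g = b at *
        revert a b
        decide
      · rw [Function.update_of_ne hg, hf g (Ne.symm hg)]

/-- Every nonzero covector is nonzero on some wall of `T`. -/
theorem eq_zero_of_forall_wall [Fintype U] [DecidableEq U] {M : OrientedMatroid U}
    (hM : M.IsSimple) {T : U → SignType} (hT : T ∈ M.topes) {X : U → SignType}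
    (hX : X ∈ M.covectors) (h : ∀ e, Function.update T e (-T e) ∈ M.topes → X e = 0) :
    X = 0 := by
  obtain ⟨hTM, hT0⟩ := (mem_topes_iff hM).1 hT
  have key (Y : U → SignType) (hY : Y ∈ M.covectors)
      (h : ∀ e, Function.update T e (-T e) ∈ M.topes → Y e = 0) : SignVec.comp Y T = T := by
    by_contra hne
    have hR : SignVec.comp Y T ∈ M.topes := by
      refine (mem_topes_iff hM).2 ⟨M.comp_mem Y hY T hTM, fun e => ?_⟩
      have := hT0 e
      unfold SignVec.comp
      grind
    obtain ⟨e, he, hw⟩ := exists_wall hM hT _ _ hR hne le_rfl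
    exact he (by simp [SignVec.comp, h e hw])
  ext1 e
  have h1 := congrFun (key X hX h) e
  have h2 := congrFun (key (-X) (M.neg_mem X hX) fun e he => by simp [h e he]) e
  simp only [SignVec.comp, Pi.neg_apply] at h1 h2
  rw [Pi.zero_apply]
  generalize X e = a at *
  generalize T e = b at *
  revert a b
  decide

/-! ### Osculation -/

theorem wall_mem_osc [Fintype U] [DecidableEq U] {M : OrientedMatroid U} (hM : M.IsSimple)
    {T : U → SignType} (hT : T ∈ M.topes) {e : U}
    (he : Function.update T e (-T e) ∈ M.topes) :
    e ∈ osc M.topeFamily {M.topeVertex T hT} := by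
  set u := M.topeVertex T hT
  set v := M.topeVertex _ he
  have hsd : symmDiff u.1 v.1 = {e} := by
    ext g
    simp only [u, v, topeVertex, positivePart, Finset.mem_symmDiff, Finset.mem_filter,
      Finset.mem_univ, true_and, Finset.mem_singleton]
    by_cases hg : g = e
    · subst hg
      have h1 := ((mem_topes_iff hM).1 hT).2 g
      rw [Function.update_self]
      simp only [iff_true]
      generalize T g = a at h1 ⊢
      revert a
      decide
    · rw [Function.update_of_ne hg]
      tauto
  have hadj : (oneInclusionGraph M.topeFamily).Adj u v := by
    change (symmDiff u.1 v.1).card = 1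
    rw [hsd, Finset.card_singleton]
  have hdist := SimpleGraph.dist_eq_one_iff_adj.2 hadj
  refine ⟨?_, u, v, ⟨u, v, u, v, hadj, hsd, hadj, ⟨?_, ?_⟩, rfl⟩, rfl, hadj.ne'⟩
  -- An edge inside a singleton would be a loop.
  · rintro ⟨a, b, ⟨-, -, u', v', -, -, h, -, hab⟩, rfl, rfl⟩
    have h' : s(u', v') ∈ (oneInclusionGraph M.topeFamily).edgeSet := h
    rw [← hab] at h'
    exact SimpleGraph.irrefl _ ((SimpleGraph.mem_edgeSet _).1 h')
  · simp [halfspace, hdist]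
  · have hdist' := SimpleGraph.dist_eq_one_iff_adj.2 hadj.symm
    simp [halfspace, hdist']

end OrientedMatroid

theorem mainTheorem5 {U : Type*} [Fintype U] [DecidableEq U] (M : OrientedMatroid U)
    (hM : M.IsSimple) (d : ℕ) (hd : M.rank = d) (T : U → SignType) (hT : T ∈ M.topes) :
    ∃ D : Finset U, (D : Set U) ⊆ osc M.topeFamily {M.topeVertex T hT} ∧
      D.card = d ∧ M.Shatters D := by
  obtain ⟨D, hD, hcard, hs⟩ := OrientedMatroid.HasChainAbove.exists_independent
    (W := {e | Function.update T e (-T e) ∈ M.topes})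
    (fun X hX h => OrientedMatroid.eq_zero_of_forall_wall hM hT hX h) M.hasChainAbove_rank
  refine ⟨D, fun e he => OrientedMatroid.wall_mem_osc hM hT (hD he), hcard.trans hd, ?_⟩
  intro Y hY
  -- The pattern has no zeros, so `X` is prescribed on all of `D` and `X ∘ T` keeps it.
  obtain ⟨X, hX, h⟩ := hs fun e => if e ∈ Y then 1 else -1
  obtain ⟨hTM, hT0⟩ := (OrientedMatroid.mem_topes_iff hM).1 hT
  refine ⟨OrientedMatroid.positivePart (SignVec.comp X T), ?_, ?_⟩
  · simp only [OrientedMatroid.topeFamily, Finset.mem_filter, Finset.mem_univ, true_and]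
    refine ⟨_, (OrientedMatroid.mem_topes_iff hM).2 ⟨M.comp_mem X hX T hTM, fun e => ?_⟩, rfl⟩
    have := hT0 e
    unfold SignVec.comp
    grind
  · ext e
    simp only [OrientedMatroid.positivePart, Finset.mem_inter, Finset.mem_filter,
      Finset.mem_univ, true_and]
    by_cases he : e ∈ D
    · have h1 := h e he (by split_ifs <;> decide)
      by_cases heY : e ∈ Y
      · simp [SignVec.comp, h1, he, heY]
      · simp [SignVec.comp, h1, he, heY]
    · simp only [he, false_and, false_iff]
      exact fun h => he (hY h)
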